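/- Let $q$ be a prime power, let $F_q$ be the field with $q$ elements, and let $Mat(n,q)$ be the set of $n\times n$ matrices over $F_q$. By the rational canonical form, every $\alpha\in Mat(n,q)$ determines a partition $\lambda_\phi(\alpha)$ (possibly empty) for each monic irreducible polynomial $\phi$ over $F_q$: $\alpha$ is similar to a block diagonal matrix whose blocks are the companion matrices $C(\phi^{j})$, with one block for each $\phi$ and each part $j$ of $\lambda_\phi(\alpha)$. Call $\alpha$ regular if every $\lambda_\phi(\alpha)$ has at most one part, semisimple if it is diagonalizable over the algebraic closure of $F_q$, and regular semisimple if it is both regular and semisimple. For fixed $q$, as $n\to\infty$, the probability that a uniformly random element of $Mat(n,q)$ is regular tends to \[ \left(1-\frac{1}{q^5}\right)\prod_{r=3}^{\infty}\left(1-\frac{1}{q^r}\right), \] and the probability that a uniformly random element of $Mat(n,q)$ is regular semisimple tends to \[ \prod_{r=1}^{\infty}\left(1-\frac{1}{q^r}\right). \] Both infinite products converge. -/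

import Mathlib

open Polynomial Filter Topology

namespace RandomMatrix

variable {F : Type*} [Field F]

/-- The companion matrix `C(p)` of a monic polynomial `p = z^d + a_{d-1} z^{d-1} + ⋯ + a_0`:
ones on the superdiagonal, last row `(-a_0, -a_1, …, -a_{d-1})`, zeros elsewhere. -/
def companion (p : F[X]) : Matrix (Fin p.natDegree) (Fin p.natDegree) F :=
  Matrix.of fun i j =>
    if (i : ℕ) + 1 = p.natDegree then -p.coeff j
    else if (j : ℕ) = (i : ℕ) + 1 then 1 else 0

open Classical in
/-- `HasRationalData A Λ` says that the rational canonical form of `A` is the one described by the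
partitions `Λ φ` (each one given as the multiset of its positive parts). That is, `A` is similar to
the block diagonal matrix with blocks `C(φ_i ^ e_i)`, where the `φ_i` are monic irreducible
polynomials, the `e_i` are positive, and for every `φ` the parts of `Λ φ` are the exponents `e_i`,
with multiplicity, of the blocks with `φ_i = φ`. The equivalence `σ` only numbers the rows and
columns of the block diagonal matrix by `Fin n`. -/
def HasRationalData {n : ℕ} (A : Matrix (Fin n) (Fin n) F) (Λ : F[X] → Multiset ℕ) : Prop :=
  ∃ (k : ℕ) (φ : Fin k → F[X]) (e : Fin k → ℕ),
    (∀ i, (φ i).Monic ∧ Irreducible (φ i) ∧ 0 < e i) ∧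
    (∀ p : F[X], Λ p = (Finset.univ.filter fun i => φ i = p).val.map e) ∧
    ∃ (σ : (Σ i, Fin (φ i ^ e i).natDegree) ≃ Fin n) (P : GL (Fin n) F),
      A = P.val *
        Matrix.reindex σ σ (Matrix.blockDiagonal' fun i => companion (φ i ^ e i)) *
        (P⁻¹).val

/-- A matrix is regular if every partition `λ_φ` of its rational canonical form has at most one
part. -/
def IsRegularMat {n : ℕ} (A : Matrix (Fin n) (Fin n) F) : Prop :=
  ∃ Λ : F[X] → Multiset ℕ, HasRationalData A Λ ∧ ∀ φ, (Λ φ).card ≤ 1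

/-- A matrix is semisimple if it is diagonalizable over the algebraic closure. -/
def IsSemisimpleMat {n : ℕ} (A : Matrix (Fin n) (Fin n) F) : Prop :=
  ∃ (P : GL (Fin n) (AlgebraicClosure F)) (d : Fin n → AlgebraicClosure F),
    A.map (algebraMap F (AlgebraicClosure F)) = P.val * Matrix.diagonal d * (P⁻¹).val

/-- A matrix is regular semisimple if it is both regular and semisimple. -/
def IsRegSemisimpleMat {n : ℕ} (A : Matrix (Fin n) (Fin n) F) : Prop :=
  IsRegularMat A ∧ IsSemisimpleMat A

/-- The probability that a uniformly distributed `n × n` matrix over the finite field `F`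
has the property `S`. -/
noncomputable def matProb (F : Type*) (n : ℕ) (S : Matrix (Fin n) (Fin n) F → Prop) : ℝ :=
  (Nat.card {A : Matrix (Fin n) (Fin n) F // S A} : ℝ) / Nat.card (Matrix (Fin n) (Fin n) F)

end RandomMatrix

/-!
Write `|f| = q ^ deg f`, and let `Φ(f)` be the number of units of `F[X] / (f)`.

*Reduction to sums over monic polynomials.* By the Chinese remainder theorem a matrix is regular
exactly when it is similar to one companion matrix `C(f)`, and then `f` is its characteristic
polynomial (`isRegularMat_iff`). The centralizer of `C(f)` is `F[X] / (f)`, so by orbit–stabilizer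
the similarity class of `C(f)` has `|GL_n| / Φ(f)` elements (`natCard_hasCompanion_mul`). An
eigenvector of `C(f)` consists of the powers of a root of `f`; hence `C(f)` is diagonalizable over
the algebraic closure exactly when `f` has distinct roots, that is, is squarefree
(`isSemisimpleMat_companion_iff`). The two probabilities are therefore `|GL_n| / q ^ (n ^ 2)`, which
tends to `∏ (1 - q⁻ʳ)`, times the sum of `1 / Φ(f)` over all, respectively over all squarefree,
monic `f` of degree `n`.

*The two sums.* Monic polynomials form the free commutative monoid on the monic irreducible ones,
and there are `q ^ n` of degree `n`; nothing else about them is needed. If a function is a divisor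
sum, `g(f) = ∑_{d ∣ f} |d| c(d)` with `∑ |c(d)| < ∞`, then its mean value over degree `n` is the sum
of `c(d)` over `deg d ≤ n`, and converges to `∑ c(d)` (`tendsto_sum_slice`).

* For `g(f) = |f| / Φ(f)`, `c` is `1 / (|d| Φ(d))` on squarefree `d`, so the limit is the Euler
  product `∏ (1 + 1 / (Q (Q - 1)))`, `Q = |p|`. Its factors are
  `(1 - Q⁻⁶) / ((1 - Q⁻²) (1 - Q⁻³))`, and `∏ (1 - Q⁻ˢ⁻¹) = 1 - q⁻ˢ`
  (`tprod_one_sub_inv_pow`), which gives `(1 - q⁻⁵) / ((1 - q⁻¹) (1 - q⁻²))`.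
* For `g(f) = |f| / Φ(f)` on squarefree `f` and `0` otherwise, `c` lives on the products `e y` with
  `e` squarefree and `y ∣ e`, where it is `μ(y) / (|e| Φ(e))`. Summing over `y ∣ e` leaves only
  `e = 1`, and the limit is `1` (`tendsto_sum_invTotient_squarefree`).
-/

namespace RandomMatrix

/-! ### Mean values of divisor sums in a free commutative monoid -/

section Semigroup

variable {P : Type*} {deg : P → ℕ} {q : ℕ}

/-- The finset of elements of weight `n` in the free commutative monoid `P →₀ ℕ`. -/
noncomputable def slice (hfin : ∀ n, {m : P →₀ ℕ | Finsupp.weight deg m = n}.Finite) (n : ℕ) :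
    Finset (P →₀ ℕ) :=
  (hfin n).toFinset

theorem mem_slice {hfin : ∀ n, {m : P →₀ ℕ | Finsupp.weight deg m = n}.Finite} {n : ℕ}
    {m : P →₀ ℕ} : m ∈ slice hfin n ↔ Finsupp.weight deg m = n := by
  simp [slice]

/-- Multiplication by `d` identifies the elements of weight `n - weight d` with the multiples of
`d` of weight `n`. -/
theorem card_slice_filter_le (hN : ∀ n, Nat.card {m : P →₀ ℕ // Finsupp.weight deg m = n} = q ^ n)
    (hfin : ∀ n, {m : P →₀ ℕ | Finsupp.weight deg m = n}.Finite) (d : P →₀ ℕ) {n : ℕ}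
    (hd : Finsupp.weight deg d ≤ n) [DecidablePred (d ≤ ·)] :
    ((slice hfin n).filter (d ≤ ·)).card = q ^ (n - Finsupp.weight deg d) := by
  have hcard : ∀ k, (slice hfin k).card = q ^ k := by
    intro k
    rw [← hN k, Nat.card_congr (Equiv.subtypeEquivRight fun m => (mem_slice (hfin := hfin)).symm),
      Nat.card_eq_fintype_card, Fintype.card_coe]
  rw [← hcard]
  symm
  refine Finset.card_bij (fun m _ => d + m) ?_ ?_ ?_
  · intro m hm
    rw [mem_slice] at hm
    rw [Finset.mem_filter, mem_slice, map_add, hm]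
    exact ⟨by omega, le_self_add⟩
  · intro m _ m' _ h
    exact add_left_cancel h
  · intro m hm
    rw [Finset.mem_filter, mem_slice] at hm
    refine ⟨m - d, ?_, add_tsub_cancel_of_le hm.2⟩
    have := congrArg (Finsupp.weight deg) (add_tsub_cancel_of_le hm.2)
    rw [map_add] at this
    rw [mem_slice]
    omega

/-- Interchanging the sum over the elements of weight `n` with the sum over their divisors `d i`:
each `d i` of weight at most `n` divides a proportion `q ^ (-weight (d i))` of them. -/
theorem sum_slice_divisors
    (hN : ∀ n, Nat.card {m : P →₀ ℕ // Finsupp.weight deg m = n} = q ^ n) (hq : 2 ≤ q)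
    (hfin : ∀ n, {m : P →₀ ℕ | Finsupp.weight deg m = n}.Finite) {ι : Type*}
    (d : ι → P →₀ ℕ) (c : ι → ℝ) (T : (P →₀ ℕ) → Finset ι) (hT : ∀ m i, i ∈ T m ↔ d i ≤ m)
    (U : ℕ → Finset ι) (hU : ∀ n i, i ∈ U n ↔ Finsupp.weight deg (d i) ≤ n) (n : ℕ) :
    ∑ m ∈ slice hfin n, ((q : ℝ) ^ n)⁻¹ * ∑ i ∈ T m, c i * (q : ℝ) ^ Finsupp.weight deg (d i) =
      ∑ i ∈ U n, c i := by
  classical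
  simp_rw [Finset.mul_sum]
  rw [Finset.sum_comm' (t' := U n) (s' := fun i => (slice hfin n).filter (d i ≤ ·))]
  · refine Finset.sum_congr rfl fun i hi => ?_
    rw [hU] at hi
    rw [Finset.sum_const, card_slice_filter_le hN hfin _ hi, nsmul_eq_mul]
    have hq0 : (q : ℝ) ≠ 0 := by positivity
    rw [Nat.cast_pow, pow_sub₀ _ hq0 hi]
    field_simp
  · intro m i
    rw [Finset.mem_filter, hT, hU, mem_slice]
    constructor
    · rintro ⟨h, h'⟩
      refine ⟨⟨h, h'⟩, ?_⟩
      obtain ⟨e, rfl⟩ := exists_add_of_le h'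
      rw [map_add] at h
      omega
    · rintro ⟨⟨h, h'⟩, _⟩
      exact ⟨h, h'⟩

/-- The finset of indices `i` for which `d i` has weight at most `n`. -/
theorem exists_finset_weight_le (hfin : ∀ n, {m : P →₀ ℕ | Finsupp.weight deg m = n}.Finite)
    {ι : Type*} (d : ι → P →₀ ℕ) (T : (P →₀ ℕ) → Finset ι) (hT : ∀ m i, i ∈ T m ↔ d i ≤ m) :
    ∃ U : ℕ → Finset ι, ∀ n i, i ∈ U n ↔ Finsupp.weight deg (d i) ≤ n := by
  have h : ∀ n, {i | Finsupp.weight deg (d i) ≤ n}.Finite := by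
    intro n
    refine Set.Finite.subset (Set.Finite.biUnion (Set.finite_Iic n) fun k _ =>
      Set.Finite.biUnion (hfin k) fun m _ => (T m).finite_toSet) ?_
    intro i hi
    simp only [Set.mem_iUnion]
    exact ⟨_, hi, d i, rfl, (hT _ _).2 le_rfl⟩
  exact ⟨fun n => (h n).toFinset, fun n i => by simp⟩

/-- The mean value over the elements of weight `n` of a divisor sum with absolutely summable
weights converges to the total weight. -/
theorem tendsto_sum_slice
    (hN : ∀ n, Nat.card {m : P →₀ ℕ // Finsupp.weight deg m = n} = q ^ n) (hq : 2 ≤ q)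
    (hfin : ∀ n, {m : P →₀ ℕ | Finsupp.weight deg m = n}.Finite) {ι : Type*}
    (d : ι → P →₀ ℕ) (c : ι → ℝ) (hc : Summable c) (T : (P →₀ ℕ) → Finset ι)
    (hT : ∀ m i, i ∈ T m ↔ d i ≤ m) :
    Tendsto (fun n => ∑ m ∈ slice hfin n,
      ((q : ℝ) ^ n)⁻¹ * ∑ i ∈ T m, c i * (q : ℝ) ^ Finsupp.weight deg (d i)) atTop
      (𝓝 (∑' i, c i)) := by
  obtain ⟨U, hU⟩ := exists_finset_weight_le hfin d T hT
  simp_rw [sum_slice_divisors hN hq hfin d c T hT U hU]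
  refine hc.hasSum.comp (tendsto_atTop_finset_of_monotone ?_ ?_)
  · intro a b hab i hi
    rw [hU] at hi ⊢
    omega
  · intro i
    exact ⟨_, (hU _ _).2 le_rfl⟩

/-- The indicator of a finset of primes: the squarefree element with these prime factors. -/
noncomputable def sqfreeOf (S : Finset P) : P →₀ ℕ := ∑ p ∈ S, Finsupp.single p 1

theorem sqfreeOf_apply [DecidableEq P] (S : Finset P) (p : P) :
    sqfreeOf S p = if p ∈ S then 1 else 0 := by
  simp [sqfreeOf, Finsupp.finsetSum_apply, Finsupp.single_apply]

theorem weight_sqfreeOf (S : Finset P) : Finsupp.weight deg (sqfreeOf S) = ∑ p ∈ S, deg p := by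
  simp [sqfreeOf, map_sum, Finsupp.weight_single]

theorem sqfreeOf_le_iff (S : Finset P) (m : P →₀ ℕ) : sqfreeOf S ≤ m ↔ S ⊆ m.support := by
  classical
  constructor
  · intro h p hp
    have := h p
    rw [sqfreeOf_apply, if_pos hp] at this
    rw [Finsupp.mem_support_iff]
    omega
  · intro h p
    rw [sqfreeOf_apply]
    split_ifs with hp
    · have := Finsupp.mem_support_iff.1 (h hp)
      omega
    · omega

theorem pow_weight_sqfreeOf (x : ℝ) (S : Finset P) :
    x ^ Finsupp.weight deg (sqfreeOf S) = ∏ p ∈ S, x ^ deg p := by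
  rw [weight_sqfreeOf, Finset.prod_pow_eq_pow_sum]

theorem two_le_pow_deg (hq : 2 ≤ q) (hdeg : ∀ p, 0 < deg p) (p : P) : (2 : ℝ) ≤ (q : ℝ) ^ deg p := by
  have h1 : (2 : ℝ) ≤ q := by exact_mod_cast hq
  calc (2 : ℝ) ≤ q := h1
    _ = (q : ℝ) ^ 1 := (pow_one _).symm
    _ ≤ (q : ℝ) ^ deg p := pow_le_pow_right₀ (by linarith) (hdeg p)

/-- The series of `q ^ (-2 * deg p)` over all primes converges, since already the series over all
elements is the geometric series of ratio `1 / q`. -/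
theorem summable_inv_sq (hN : ∀ n, Nat.card {m : P →₀ ℕ // Finsupp.weight deg m = n} = q ^ n)
    (hq : 2 ≤ q) : Summable fun p : P => (((q : ℝ) ^ deg p) ^ 2)⁻¹ := by
  have hq1 : (2 : ℝ) ≤ q := by exact_mod_cast hq
  have hM : Summable fun m : P →₀ ℕ => (((q : ℝ) ^ Finsupp.weight deg m) ^ 2)⁻¹ := by
    rw [← (Equiv.sigmaFiberEquiv (Finsupp.weight deg : (P →₀ ℕ) → ℕ)).summable_iff]
    rw [summable_sigma_of_nonneg (fun _ => by simp only [Function.comp]; positivity)]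
    have hfin : ∀ n, Finite {m : P →₀ ℕ // Finsupp.weight deg m = n} := fun n =>
      Nat.finite_of_card_ne_zero (by rw [hN]; positivity)
    refine ⟨fun n => Summable.of_finite, ?_⟩
    have : (fun n => ∑' y : {m : P →₀ ℕ // Finsupp.weight deg m = n},
        ((fun m : P →₀ ℕ => (((q : ℝ) ^ Finsupp.weight deg m) ^ 2)⁻¹) ∘
          (Equiv.sigmaFiberEquiv (Finsupp.weight deg : (P →₀ ℕ) → ℕ))) ⟨n, y⟩) =
        fun n : ℕ => ((q : ℝ)⁻¹) ^ n := by
      funext n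
      have h1 : ∀ y : {m : P →₀ ℕ // Finsupp.weight deg m = n},
          ((fun m : P →₀ ℕ => (((q : ℝ) ^ Finsupp.weight deg m) ^ 2)⁻¹) ∘
          (Equiv.sigmaFiberEquiv (Finsupp.weight deg : (P →₀ ℕ) → ℕ))) ⟨n, y⟩ =
          (((q : ℝ) ^ n) ^ 2)⁻¹ := by
        intro y
        simp [Equiv.sigmaFiberEquiv, y.2]
      rw [tsum_congr h1, tsum_const, hN, nsmul_eq_mul, inv_pow]
      push_cast
      field_simp
    rw [this]
    exact summable_geometric_of_lt_one (by positivity) (inv_lt_one_of_one_lt₀ (by linarith))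
  have := hM.comp_injective (i := fun p : P => Finsupp.single p 1)
    (Finsupp.single_left_injective one_ne_zero)
  refine this.congr fun p => ?_
  simp [Finsupp.weight_single]

theorem inv_mul_sub_one_le {Q : ℝ} (hQ : 2 ≤ Q) : (Q * (Q - 1))⁻¹ ≤ 2 * (Q ^ 2)⁻¹ := by
  have h1 : 0 < Q * (Q - 1) := mul_pos (by linarith) (by linarith)
  rw [show 2 * (Q ^ 2)⁻¹ = (Q ^ 2 / 2)⁻¹ by field_simp]
  exact inv_anti₀ (by positivity) (by nlinarith)

theorem summable_inv_mul_sub_one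
    (hN : ∀ n, Nat.card {m : P →₀ ℕ // Finsupp.weight deg m = n} = q ^ n)
    (hq : 2 ≤ q) (hdeg : ∀ p, 0 < deg p) :
    Summable fun p : P => ((q : ℝ) ^ deg p * ((q : ℝ) ^ deg p - 1))⁻¹ := by
  refine Summable.of_nonneg_of_le (fun p => ?_) (fun p => ?_) ((summable_inv_sq hN hq).mul_left 2)
  · have := two_le_pow_deg hq hdeg p
    exact inv_nonneg.2 (mul_nonneg (by linarith) (by linarith))
  · exact inv_mul_sub_one_le (two_le_pow_deg hq hdeg p)

/-- The reciprocal of the number of units modulo the element `m`, as an Euler product. -/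
noncomputable def invTotient (deg : P → ℕ) (q : ℕ) (m : P →₀ ℕ) : ℝ :=
  (∏ p ∈ m.support, ((q : ℝ) ^ deg p) ^ (m p - 1) * ((q : ℝ) ^ deg p - 1))⁻¹

theorem invTotient_eq (hq : 2 ≤ q) (hdeg : ∀ p, 0 < deg p) (m : P →₀ ℕ) :
    invTotient deg q m = ((q : ℝ) ^ Finsupp.weight deg m)⁻¹ *
      ∏ p ∈ m.support, (1 + ((q : ℝ) ^ deg p - 1)⁻¹) := by
  rw [invTotient, Finsupp.weight_apply, Finsupp.sum, ← Finset.prod_pow_eq_pow_sum,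
    ← Finset.prod_inv_distrib, ← Finset.prod_inv_distrib, ← Finset.prod_mul_distrib]
  refine Finset.prod_congr rfl fun p hp => ?_
  have h2 := two_le_pow_deg hq hdeg p
  have h0 : (q : ℝ) ^ deg p ≠ 0 := by linarith
  have h1 : (q : ℝ) ^ deg p - 1 ≠ 0 := by linarith
  obtain ⟨k, hk⟩ := Nat.exists_eq_succ_of_ne_zero (Finsupp.mem_support_iff.1 hp)
  rw [hk, smul_eq_mul, mul_comm, pow_mul, Nat.succ_sub_one, Nat.succ_eq_add_one, pow_succ]
  field_simp
  ring

theorem finite_slices (hN : ∀ n, Nat.card {m : P →₀ ℕ // Finsupp.weight deg m = n} = q ^ n)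
    (hq : 2 ≤ q) (n : ℕ) : {m : P →₀ ℕ | Finsupp.weight deg m = n}.Finite :=
  Nat.finite_of_card_ne_zero (α := {m : P →₀ ℕ // Finsupp.weight deg m = n})
    (by rw [hN]; positivity)

theorem tendsto_sum_invTotient_tprod
    (hN : ∀ n, Nat.card {m : P →₀ ℕ // Finsupp.weight deg m = n} = q ^ n)
    (hq : 2 ≤ q) (hdeg : ∀ p, 0 < deg p)
    (hfin : ∀ n, {m : P →₀ ℕ | Finsupp.weight deg m = n}.Finite) :
    Tendsto (fun n => ∑ m ∈ slice hfin n, invTotient deg q m) atTop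
      (𝓝 (∏' p : P, (1 + ((q : ℝ) ^ deg p * ((q : ℝ) ^ deg p - 1))⁻¹))) := by
  have hs : Summable fun S : Finset P =>
      ∏ p ∈ S, ((q : ℝ) ^ deg p * ((q : ℝ) ^ deg p - 1))⁻¹ :=
    summable_finsetProd_of_summable_norm (summable_inv_mul_sub_one hN hq hdeg).norm
  rw [tprod_one_add hs]
  refine (tendsto_sum_slice hN hq hfin sqfreeOf _ hs (fun m => m.support.powerset)
    fun m S => by rw [Finset.mem_powerset, sqfreeOf_le_iff]).congr fun n => ?_
  refine Finset.sum_congr rfl fun m hm => ?_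
  rw [mem_slice] at hm
  rw [invTotient_eq hq hdeg, hm, Finset.prod_one_add]
  congr 1
  refine Finset.sum_congr rfl fun S _ => ?_
  rw [pow_weight_sqfreeOf, ← Finset.prod_mul_distrib]
  refine Finset.prod_congr rfl fun p _ => ?_
  have h2 := two_le_pow_deg hq hdeg p
  have h0 : (q : ℝ) ^ deg p ≠ 0 := by linarith
  field_simp

/-- The Euler product of the inverse zeta function, `∏ (1 - q ^ (-(s + 1) deg p)) = 1 - q ^ (-s)`.
The partial sums by weight of the expanded product are evaluated exactly, because
`∑ μ(S)` over the squarefree divisors of an element vanishes unless the element is `1`. -/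
theorem tprod_one_sub_inv_pow
    (hN : ∀ n, Nat.card {m : P →₀ ℕ // Finsupp.weight deg m = n} = q ^ n)
    (hq : 2 ≤ q) (hdeg : ∀ p, 0 < deg p) (s : ℕ) (hs : 1 ≤ s) :
    Multipliable (fun p : P => 1 + -(((q : ℝ) ^ deg p) ^ (s + 1))⁻¹) ∧
    ∏' p : P, (1 + -(((q : ℝ) ^ deg p) ^ (s + 1))⁻¹) = 1 - ((q : ℝ) ^ s)⁻¹ := by
  have hfin := finite_slices hN hq
  have hq0 : (q : ℝ) ≠ 0 := by positivity
  have hsum : Summable fun p : P => -(((q : ℝ) ^ deg p) ^ (s + 1))⁻¹ := by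
    refine Summable.of_norm_bounded (summable_inv_sq hN hq) fun p => ?_
    have := two_le_pow_deg hq hdeg p
    rw [norm_neg, norm_inv, norm_pow, Real.norm_of_nonneg (by linarith)]
    exact inv_anti₀ (by positivity) (pow_le_pow_right₀ (by linarith) (by omega))
  have hsum' := summable_finsetProd_of_summable_norm hsum.norm
  refine ⟨Real.multipliable_one_add_of_summable hsum, ?_⟩
  rw [tprod_one_add hsum']
  have hT : ∀ (m : P →₀ ℕ) S, S ∈ m.support.powerset ↔ sqfreeOf S ≤ m := fun m S => by
    rw [Finset.mem_powerset, sqfreeOf_le_iff]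
  obtain ⟨U, hU⟩ := exists_finset_weight_le hfin sqfreeOf _ hT
  -- Sums of `μ(S) * q ^ (-weight S)` over all squarefree elements of weight at most `n`.
  have hmoeb : ∀ n, ∑ S ∈ U n, ∏ p ∈ S, -((q : ℝ) ^ deg p)⁻¹ = if n = 0 then 1 else 0 := by
    classical
    intro n
    rw [← sum_slice_divisors hN hq hfin sqfreeOf _ _ hT U hU]
    have h1 : ∀ m ∈ slice hfin n, ((q : ℝ) ^ n)⁻¹ * ∑ S ∈ m.support.powerset,
        (∏ p ∈ S, -((q : ℝ) ^ deg p)⁻¹) * (q : ℝ) ^ Finsupp.weight deg (sqfreeOf S) =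
        if m = 0 then 1 else 0 := by
      intro m hm
      have h2 : ∀ S : Finset P, (∏ p ∈ S, -((q : ℝ) ^ deg p)⁻¹) *
          (q : ℝ) ^ Finsupp.weight deg (sqfreeOf S) = ∏ p ∈ S, (-1 : ℝ) := by
        intro S
        rw [pow_weight_sqfreeOf, ← Finset.prod_mul_distrib]
        refine Finset.prod_congr rfl fun p _ => ?_
        field_simp
      simp_rw [h2]
      rw [← Finset.prod_one_add]
      split_ifs with h0
      · subst h0
        rw [mem_slice, map_zero] at hm
        simp [← hm]
      · obtain ⟨p, hp⟩ := Finsupp.support_nonempty_iff.2 h0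
        rw [Finset.prod_eq_zero hp (by ring), mul_zero]
    rw [Finset.sum_congr rfl h1, Finset.sum_ite_eq']
    simp only [mem_slice, map_zero, eq_comm]
  have hval : ∀ n, ∑ S ∈ U (n + 1), ∏ p ∈ S, -(((q : ℝ) ^ deg p) ^ (s + 1))⁻¹ =
      1 - ((q : ℝ) ^ s)⁻¹ := by
    have hterm : ∀ S : Finset P, ∏ p ∈ S, -(((q : ℝ) ^ deg p) ^ (s + 1))⁻¹ =
        (∏ p ∈ S, -((q : ℝ) ^ deg p)⁻¹) * ((q : ℝ) ^ (s * Finsupp.weight deg (sqfreeOf S)))⁻¹ := by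
      intro S
      rw [mul_comm s, pow_mul, pow_weight_sqfreeOf, ← Finset.prod_pow, ← Finset.prod_inv_distrib,
        ← Finset.prod_mul_distrib]
      refine Finset.prod_congr rfl fun p _ => ?_
      rw [pow_succ, mul_inv]
      ring
    -- The squarefree elements of weight exactly `n + 1`, as a difference.
    have hstep : ∀ n, ∑ S ∈ U (n + 1), ∏ p ∈ S, -(((q : ℝ) ^ deg p) ^ (s + 1))⁻¹ =
        ∑ S ∈ U n, ∏ p ∈ S, -(((q : ℝ) ^ deg p) ^ (s + 1))⁻¹ +
        (∑ S ∈ U (n + 1), ∏ p ∈ S, -((q : ℝ) ^ deg p)⁻¹ -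
          ∑ S ∈ U n, ∏ p ∈ S, -((q : ℝ) ^ deg p)⁻¹) * ((q : ℝ) ^ (s * (n + 1)))⁻¹ := by
      classical
      intro n
      have hsub : U n ⊆ U (n + 1) := fun S hS => by
        rw [hU] at hS ⊢
        omega
      rw [← Finset.sum_sdiff hsub, ← Finset.sum_sdiff hsub (f := fun S => ∏ p ∈ S, -((q : ℝ) ^ _)⁻¹),
        add_sub_cancel_right, Finset.sum_mul, add_comm]
      congr 1
      refine Finset.sum_congr rfl fun S hS => ?_
      rw [Finset.mem_sdiff, hU, hU] at hS
      rw [hterm, show Finsupp.weight deg (sqfreeOf S) = n + 1 by omega]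
    have h0 : ∑ S ∈ U 0, ∏ p ∈ S, -(((q : ℝ) ^ deg p) ^ (s + 1))⁻¹ = 1 := by
      have := hmoeb 0
      rw [if_pos rfl] at this
      rw [← this]
      refine Finset.sum_congr rfl fun S hS => ?_
      rw [hU] at hS
      rw [hterm, show Finsupp.weight deg (sqfreeOf S) = 0 by omega]
      simp
    intro n
    induction n with
    | zero =>
      rw [hstep, h0, hmoeb, hmoeb]
      simp [sub_eq_add_neg]
    | succ n ih =>
      rw [hstep, ih, hmoeb, hmoeb]
      simp
  refine tendsto_nhds_unique (hsum'.hasSum.comp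
    (tendsto_atTop_finset_of_monotone (f := fun n => U (n + 1)) ?_ ?_)) ?_
  · intro a b hab S hS
    simp only [hU] at hS ⊢
    omega
  · intro S
    exact ⟨_, (hU _ _).2 (Nat.le_succ _)⟩
  · simp only [Function.comp_def, hval]
    exact tendsto_const_nhds

/-- The Euler factor `1 + 1 / (Q (Q - 1))` equals
`(1 - Q⁻⁶) / ((1 - Q⁻²) (1 - Q⁻³))`, so the product is a quotient of zeta values. -/
theorem tendsto_sum_invTotient
    (hN : ∀ n, Nat.card {m : P →₀ ℕ // Finsupp.weight deg m = n} = q ^ n)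
    (hq : 2 ≤ q) (hdeg : ∀ p, 0 < deg p)
    (hfin : ∀ n, {m : P →₀ ℕ | Finsupp.weight deg m = n}.Finite) :
    Tendsto (fun n => ∑ m ∈ slice hfin n, invTotient deg q m) atTop
      (𝓝 ((1 - ((q : ℝ) ^ 5)⁻¹) / ((1 - ((q : ℝ) ^ 1)⁻¹) * (1 - ((q : ℝ) ^ 2)⁻¹)))) := by
  convert tendsto_sum_invTotient_tprod hN hq hdeg hfin using 2
  obtain ⟨m1, e1⟩ := tprod_one_sub_inv_pow hN hq hdeg 1 le_rfl
  obtain ⟨m2, e2⟩ := tprod_one_sub_inv_pow hN hq hdeg 2 (by norm_num)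
  obtain ⟨m5, e5⟩ := tprod_one_sub_inv_pow hN hq hdeg 5 (by norm_num)
  have m0 : Multipliable fun p : P => 1 + ((q : ℝ) ^ deg p * ((q : ℝ) ^ deg p - 1))⁻¹ :=
    Real.multipliable_one_add_of_summable (summable_inv_mul_sub_one hN hq hdeg)
  have hq2 : (2 : ℝ) ≤ q := by exact_mod_cast hq
  have hlt : ∀ k : ℕ, k ≠ 0 → 1 - ((q : ℝ) ^ k)⁻¹ ≠ 0 := fun k hk =>
    (sub_pos.2 (inv_lt_one_of_one_lt₀ (one_lt_pow₀ (by linarith) hk))).ne'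
  rw [div_eq_iff (mul_ne_zero (hlt 1 one_ne_zero) (hlt 2 two_ne_zero)), ← e1, ← e2, ← e5,
    ← m1.tprod_mul m2, ← m0.tprod_mul (m1.mul m2)]
  refine tprod_congr fun p => ?_
  have h2 := two_le_pow_deg hq hdeg p
  generalize (q : ℝ) ^ deg p = Q at *
  have h0 : Q ≠ 0 := by linarith
  have h1 : Q - 1 ≠ 0 := by linarith
  field_simp
  ring

/-- Divisor-sum expansion of the function that is `|m|` over the totient on squarefree `m` and zero
elsewhere. Here `A` is the set of primes dividing `m` and `B` that of the primes of multiplicity at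
least two; a pair `x = (e, y)` with `y ⊆ e` stands for the divisor `e * y`. At a prime of `B` the
three possibilities for the exponent in `e * y` add up to zero. -/
theorem sum_pairs_eq (hq : 2 ≤ q) (hdeg : ∀ p, 0 < deg p) [DecidableEq P] (A B : Finset P) :
    ∑ x ∈ A.powerset ×ˢ A.powerset with x.2 ⊆ B,
      (if x.2 ⊆ x.1 then (-1 : ℝ) ^ x.2.card *
        ∏ p ∈ x.1, ((q : ℝ) ^ deg p * ((q : ℝ) ^ deg p - 1))⁻¹ else 0) *
      ((∏ p ∈ x.1, (q : ℝ) ^ deg p) * ∏ p ∈ x.2, (q : ℝ) ^ deg p) =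
    ∏ p ∈ A, if p ∈ B then 0 else 1 + ((q : ℝ) ^ deg p - 1)⁻¹ := by
  have hR : ∏ p ∈ A, (if p ∈ B then 0 else 1 + ((q : ℝ) ^ deg p - 1)⁻¹) =
      ∏ p ∈ A, (1 + ((q : ℝ) ^ deg p - 1)⁻¹ * if p ∈ B then 1 + -(q : ℝ) ^ deg p else 1) := by
    refine Finset.prod_congr rfl fun p _ => ?_
    have h2 := two_le_pow_deg hq hdeg p
    have h1 : (q : ℝ) ^ deg p - 1 ≠ 0 := by linarith
    split_ifs
    · field_simp
      ring
    · ring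
  rw [hR, Finset.prod_one_add, Finset.sum_filter, Finset.sum_product]
  refine Finset.sum_congr rfl fun e he => ?_
  rw [Finset.prod_mul_distrib, Finset.prod_ite_mem, Finset.prod_one_add, Finset.mul_sum]
  rw [Finset.mem_powerset] at he
  symm
  refine Finset.sum_subset_zero_on_sdiff ?_ ?_ ?_
  · exact Finset.powerset_mono.2 (Finset.inter_subset_left.trans he)
  · intro y hy
    rw [Finset.mem_sdiff, Finset.mem_powerset, Finset.mem_powerset, Finset.subset_inter_iff] at hy
    dsimp only
    split_ifs with h1 h2
    · exact absurd ⟨h2, h1⟩ hy.2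
    · rw [zero_mul]
    · rfl
  · intro y hy
    rw [Finset.mem_powerset, Finset.subset_inter_iff] at hy
    dsimp only
    rw [if_pos hy.2, if_pos hy.1]
    have : ∏ p ∈ e, ((q : ℝ) ^ deg p - 1)⁻¹ =
        (∏ p ∈ e, ((q : ℝ) ^ deg p * ((q : ℝ) ^ deg p - 1))⁻¹) * ∏ p ∈ e, (q : ℝ) ^ deg p := by
      rw [← Finset.prod_mul_distrib]
      refine Finset.prod_congr rfl fun p _ => ?_
      have h2 := two_le_pow_deg hq hdeg p
      have h0 : (q : ℝ) ^ deg p ≠ 0 := by linarith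
      field_simp
    rw [this, Finset.prod_neg]
    ring

theorem sqfreeOf_add_le_iff [DecidableEq P] {e y : Finset P} (m : P →₀ ℕ) :
    (e ⊆ m.support ∧ y ⊆ m.support ∧ y ∩ e ⊆ m.support.filter (2 ≤ m ·)) ↔
      sqfreeOf e + sqfreeOf y ≤ m := by
  simp only [Finsupp.le_def, Finsupp.add_apply, sqfreeOf_apply, Finset.subset_iff,
    Finsupp.mem_support_iff, Finset.mem_filter, Finset.mem_inter]
  constructor
  · rintro ⟨h1, h2, h3⟩ p
    have h1 := @h1 p
    have h2 := @h2 p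
    have h3 := @h3 p
    by_cases he : p ∈ e <;> by_cases hy : p ∈ y <;> simp only [he, hy, if_true, if_false] <;>
      simp only [he, hy] at h1 h2 h3 <;> grind
  · intro h
    refine ⟨fun p hp => ?_, fun p hp => ?_, fun p hp => ?_⟩ <;> have := h p <;> grind

/-- There are `2 ^ #e` subsets `y` of `e`, so the double series is dominated by the expansion of
`∏ (1 + 2 / (Q (Q - 1)))`. -/
theorem summable_pairs (hN : ∀ n, Nat.card {m : P →₀ ℕ // Finsupp.weight deg m = n} = q ^ n)
    (hq : 2 ≤ q) (hdeg : ∀ p, 0 < deg p) [DecidableEq P] :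
    Summable fun x : Finset P × Finset P => if x.2 ⊆ x.1 then (-1 : ℝ) ^ x.2.card *
        ∏ p ∈ x.1, ((q : ℝ) ^ deg p * ((q : ℝ) ^ deg p - 1))⁻¹ else 0 := by
  have hnn : ∀ p : P, 0 ≤ ((q : ℝ) ^ deg p * ((q : ℝ) ^ deg p - 1))⁻¹ := fun p => by
    have := two_le_pow_deg hq hdeg p
    exact inv_nonneg.2 (mul_nonneg (by linarith) (by linarith))
  rw [← summable_norm_iff, summable_prod_of_nonneg (fun _ => norm_nonneg _)]
  have hz : ∀ e y : Finset P, y ∉ e.powerset → ‖if y ⊆ e then (-1 : ℝ) ^ y.card *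
      ∏ p ∈ e, ((q : ℝ) ^ deg p * ((q : ℝ) ^ deg p - 1))⁻¹ else 0‖ = 0 := by
    intro e y hy
    rw [if_neg (by simpa using hy), norm_zero]
  refine ⟨fun e => summable_of_ne_finset_zero (hz e), ?_⟩
  have := summable_finsetProd_of_summable_norm
    ((summable_inv_mul_sub_one hN hq hdeg).mul_left 2).norm
  refine this.congr fun e => ?_
  rw [tsum_eq_sum (hz e), Finset.prod_mul_distrib, Finset.prod_const]
  rw [Finset.sum_congr rfl (g := fun _ => ∏ p ∈ e, ((q : ℝ) ^ deg p * ((q : ℝ) ^ deg p - 1))⁻¹)]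
  · rw [Finset.sum_const, Finset.card_powerset, nsmul_eq_mul]
    push_cast
    rfl
  · intro y hy
    rw [if_pos (Finset.mem_powerset.1 hy), norm_mul, norm_pow, norm_neg, norm_one, one_pow, one_mul,
      Real.norm_of_nonneg (Finset.prod_nonneg fun p _ => hnn p)]

/-- The signed sum over the subsets of a nonempty `e` vanishes, so only `e = ∅` contributes. -/
theorem tsum_pairs (hN : ∀ n, Nat.card {m : P →₀ ℕ // Finsupp.weight deg m = n} = q ^ n)
    (hq : 2 ≤ q) (hdeg : ∀ p, 0 < deg p) [DecidableEq P] :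
    ∑' x : Finset P × Finset P, (if x.2 ⊆ x.1 then (-1 : ℝ) ^ x.2.card *
        ∏ p ∈ x.1, ((q : ℝ) ^ deg p * ((q : ℝ) ^ deg p - 1))⁻¹ else 0) = 1 := by
  rw [(summable_pairs hN hq hdeg).tsum_prod, tsum_eq_single ∅]
  · rw [tsum_eq_single ∅]
    · simp
    · intro y hy
      rw [if_neg (by simpa using hy)]
  · intro e he
    rw [tsum_eq_sum (s := e.powerset)]
    · rw [Finset.sum_congr rfl fun y hy => if_pos (Finset.mem_powerset.1 hy)]
      dsimp only
      rw [← Finset.sum_mul]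
      have := Finset.prod_one_add (f := fun _ : P => (-1 : ℝ)) e
      simp only [Finset.prod_const] at this
      rw [← this, add_neg_cancel, zero_pow (Finset.card_ne_zero.2 (Finset.nonempty_iff_ne_empty.2 he)),
        zero_mul]
    · intro y hy
      rw [if_neg (by simpa using hy)]

theorem tendsto_sum_invTotient_squarefree
    (hN : ∀ n, Nat.card {m : P →₀ ℕ // Finsupp.weight deg m = n} = q ^ n)
    (hq : 2 ≤ q) (hdeg : ∀ p, 0 < deg p)
    (hfin : ∀ n, {m : P →₀ ℕ | Finsupp.weight deg m = n}.Finite)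
    [DecidablePred fun m : P →₀ ℕ => ∀ p, m p ≤ 1] :
    Tendsto (fun n => ∑ m ∈ slice hfin n with ∀ p, m p ≤ 1, invTotient deg q m) atTop (𝓝 1) := by
  classical
  rw [← tsum_pairs hN hq hdeg]
  refine (tendsto_sum_slice hN hq hfin (fun x => sqfreeOf x.1 + sqfreeOf x.2) _
    (summable_pairs hN hq hdeg) (fun m => (m.support.powerset ×ˢ m.support.powerset).filter
      fun x => x.2 ∩ x.1 ⊆ m.support.filter (2 ≤ m ·))
    fun m x => by
      rw [← sqfreeOf_add_le_iff, Finset.mem_filter, Finset.mem_product, Finset.mem_powerset,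
        Finset.mem_powerset, and_assoc]).congr fun n => ?_
  rw [Finset.sum_filter]
  refine Finset.sum_congr rfl fun m hm => ?_
  rw [mem_slice] at hm
  have key := sum_pairs_eq hq hdeg m.support (m.support.filter (2 ≤ m ·))
  have hprod : ∏ p ∈ m.support, (if p ∈ m.support.filter (2 ≤ m ·) then 0
      else 1 + ((q : ℝ) ^ deg p - 1)⁻¹) =
      if ∀ p, m p ≤ 1 then ∏ p ∈ m.support, (1 + ((q : ℝ) ^ deg p - 1)⁻¹) else 0 := by
    split_ifs with h
    · refine Finset.prod_congr rfl fun p _ => if_neg ?_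
      have := h p
      simp
      omega
    · push Not at h
      obtain ⟨p, hp⟩ := h
      have hps : p ∈ m.support := Finsupp.mem_support_iff.2 (by omega)
      exact Finset.prod_eq_zero hps (if_pos (Finset.mem_filter.2 ⟨hps, hp⟩))
  rw [hprod] at key
  rw [Finset.sum_filter] at key ⊢
  have hterm : ∀ x ∈ m.support.powerset ×ˢ m.support.powerset,
      (if x.2 ∩ x.1 ⊆ m.support.filter (2 ≤ m ·) then (if x.2 ⊆ x.1 then (-1 : ℝ) ^ x.2.card *
        ∏ p ∈ x.1, ((q : ℝ) ^ deg p * ((q : ℝ) ^ deg p - 1))⁻¹ else 0) *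
        (q : ℝ) ^ Finsupp.weight deg (sqfreeOf x.1 + sqfreeOf x.2) else 0) =
      if x.2 ⊆ m.support.filter (2 ≤ m ·) then (if x.2 ⊆ x.1 then (-1 : ℝ) ^ x.2.card *
        ∏ p ∈ x.1, ((q : ℝ) ^ deg p * ((q : ℝ) ^ deg p - 1))⁻¹ else 0) *
        ((∏ p ∈ x.1, (q : ℝ) ^ deg p) * ∏ p ∈ x.2, (q : ℝ) ^ deg p) else 0 := by
    intro x _
    by_cases hx : x.2 ⊆ x.1
    · rw [Finset.inter_eq_left.2 hx, map_add, pow_add, pow_weight_sqfreeOf, pow_weight_sqfreeOf]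
    · simp [hx]
  rw [Finset.sum_congr rfl hterm, key]
  split_ifs
  · rw [invTotient_eq hq hdeg, hm]
  · rw [mul_zero]

end Semigroup

/-! ### Monic polynomials and units modulo a polynomial -/

section Poly

variable {F : Type*} [Field F]

/-- The monic irreducible polynomials over `F`. -/
abbrev MonicIrr (F : Type*) [Field F] := {p : F[X] // p.Monic ∧ Irreducible p}

/-- The degree of a monic irreducible polynomial. -/
noncomputable abbrev primeDeg (F : Type*) [Field F] (p : MonicIrr F) : ℕ := p.1.natDegree

theorem primeDeg_pos (p : MonicIrr F) : 0 < primeDeg F p := p.2.2.natDegree_pos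

/-- The monic polynomial with prescribed multiplicities of its irreducible factors. -/
noncomputable def toPoly (m : MonicIrr F →₀ ℕ) : F[X] := m.prod fun p k => p.1 ^ k

theorem monic_toPoly (m : MonicIrr F →₀ ℕ) : (toPoly m).Monic :=
  monic_prod_of_monic _ _ fun p _ => p.2.1.pow _

theorem natDegree_toPoly (m : MonicIrr F →₀ ℕ) :
    (toPoly m).natDegree = Finsupp.weight (primeDeg F) m := by
  rw [toPoly, Finsupp.prod, natDegree_prod_of_monic _ _ fun p _ => p.2.1.pow _,
    Finsupp.weight_apply, Finsupp.sum]
  exact Finset.sum_congr rfl fun p _ => by rw [natDegree_pow, smul_eq_mul]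

theorem toPoly_eq_multiset_prod (m : MonicIrr F →₀ ℕ) :
    toPoly m = (m.toMultiset.map Subtype.val).prod := by
  classical
  rw [toPoly, Finsupp.toMultiset_map, Finsupp.prod_toMultiset, Finsupp.prod_mapDomain_index]
  · simp
  · intro p a b
    rw [pow_add]

theorem toPoly_injective : Function.Injective (toPoly (F := F)) := by
  classical
  intro m m' h
  rw [toPoly_eq_multiset_prod, toPoly_eq_multiset_prod] at h
  have hmem : ∀ (k : MonicIrr F →₀ ℕ), ∀ x ∈ k.toMultiset.map Subtype.val,
      x.Monic ∧ Irreducible x := by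
    intro k x hx
    obtain ⟨p, _, rfl⟩ := Multiset.mem_map.1 hx
    exact p.2
  have hrel := UniqueFactorizationMonoid.factors_unique (fun x hx => (hmem m x hx).2)
    (fun x hx => (hmem m' x hx).2) (Associated.of_eq h)
  have heq : m.toMultiset.map Subtype.val = m'.toMultiset.map Subtype.val := by
    rw [← Multiset.rel_eq]
    refine hrel.mono fun a ha b hb hab => ?_
    exact eq_of_monic_of_associated (hmem m a ha).1 (hmem m' b hb).1 hab
  exact Multiset.toFinsupp.symm.injective (Multiset.map_injective Subtype.val_injective heq)

theorem exists_toPoly_eq {f : F[X]} (hf : f.Monic) : ∃ m, toPoly m = f := by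
  classical
  have hprod : (UniqueFactorizationMonoid.normalizedFactors f).prod = f := by
    rw [UniqueFactorizationMonoid.prod_normalizedFactors_eq hf.ne_zero, hf.normalize_eq_self]
  have hs : ∀ x ∈ UniqueFactorizationMonoid.normalizedFactors f, x.Monic ∧ Irreducible x := by
    intro x hx
    rw [Polynomial.mem_normalizedFactors_iff hf.ne_zero] at hx
    exact ⟨hx.2.1, hx.1⟩
  generalize UniqueFactorizationMonoid.normalizedFactors f = s at hprod hs
  lift s to Multiset (MonicIrr F) using hs
  refine ⟨Multiset.toFinsupp s, ?_⟩
  rw [toPoly_eq_multiset_prod, Multiset.toFinsupp_toMultiset, hprod]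

theorem isCoprime_of_ne {p p' : F[X]} (hp : p.Monic ∧ Irreducible p) (hp' : p'.Monic ∧ Irreducible p')
    (hne : p ≠ p') : IsCoprime p p' :=
  (hp.2.isCoprime_or_dvd p').elim id fun hd => absurd
    (eq_of_monic_of_associated hp.1 hp'.1 ((hp.2.dvd_irreducible_iff_associated hp'.2).1 hd)) hne

theorem squarefree_toPoly_iff (m : MonicIrr F →₀ ℕ) :
    Squarefree (toPoly m) ↔ ∀ p, m p ≤ 1 := by
  classical
  constructor
  · intro h p
    by_contra! h2
    have hdvd : p.1 * p.1 ∣ toPoly m := by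
      rw [← sq]
      exact (pow_dvd_pow _ h2).trans
        (Finset.dvd_prod_of_mem _ (Finsupp.mem_support_iff.2 (by omega)))
    exact p.2.2.not_isUnit (h _ hdvd)
  · intro h
    rw [toPoly, Finsupp.prod]
    refine Finset.squarefree_prod_of_pairwise_isCoprime ?_ ?_
    · intro p _ p' _ hne
      exact (isCoprime_of_ne p.2 p'.2 fun h => hne (Subtype.ext h)).pow.isRelPrime
    · intro p hp
      have h1 := h p
      have h0 := Finsupp.mem_support_iff.1 hp
      rw [show m p = 1 by omega, pow_one]
      exact p.2.2.squarefree

theorem natCard_isUnit (M : Type*) [Monoid M] : Nat.card {x : M // IsUnit x} = Nat.card Mˣ :=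
  (Nat.card_congr (Equiv.ofBijective (fun u : Mˣ => (⟨u.1, u.isUnit⟩ : {x : M // IsUnit x}))
    ⟨fun _ _ h => Units.ext (congrArg Subtype.val h), fun x => ⟨x.2.unit, rfl⟩⟩)).symm

theorem algHomOfDvd_mk {f g : F[X]} (h : g ∣ f) (x : F[X]) :
    AdjoinRoot.algHomOfDvd F f g h (AdjoinRoot.mk f x) = AdjoinRoot.mk g x := by
  rw [← AdjoinRoot.aeval_eq, ← AdjoinRoot.aeval_eq, ← aeval_algHom_apply,
    AdjoinRoot.algHomOfDvd_root]

theorem natCard_adjoinRoot [Finite F] {f : F[X]} (hf : f.Monic) :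
    Nat.card (AdjoinRoot f) = Nat.card F ^ f.natDegree := by
  rw [Nat.card_congr (AdjoinRoot.powerBasis' hf).basis.equivFun.toEquiv, Nat.card_fun,
    Nat.card_fin, AdjoinRoot.powerBasis'_dim]

theorem finite_adjoinRoot [Finite F] {f : F[X]} (hf : f.Monic) : Finite (AdjoinRoot f) :=
  Finite.of_equiv _ (AdjoinRoot.powerBasis' hf).basis.equivFun.toEquiv.symm

/-- There are `q ^ n` monic polynomials of degree `n`, by unique factorization counted through
their multiplicities. -/
theorem natCard_monic [Finite F] (n : ℕ) :
    Nat.card {m : MonicIrr F →₀ ℕ // Finsupp.weight (primeDeg F) m = n} = Nat.card F ^ n := by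
  have e : {m : MonicIrr F →₀ ℕ // Finsupp.weight (primeDeg F) m = n} ≃
      {p : F[X] // p.Monic ∧ p.natDegree = n} := by
    refine Equiv.ofBijective (fun m => ⟨toPoly m.1, monic_toPoly _, by
      rw [natDegree_toPoly, m.2]⟩) ⟨?_, ?_⟩
    · intro m m' h
      exact Subtype.ext (toPoly_injective (congrArg Subtype.val h))
    · rintro ⟨f, hf, hn⟩
      obtain ⟨m, rfl⟩ := exists_toPoly_eq hf
      exact ⟨⟨m, by rw [← natDegree_toPoly, hn]⟩, rfl⟩
  rw [Nat.card_congr (e.trans ((monicEquivDegreeLT n).trans (degreeLTEquiv F n).toEquiv)),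
    Nat.card_fun, Nat.card_fin]

/-- The Chinese remainder theorem for `F[X] / (∏ g i)`. -/
theorem adjoinRoot_prod_bijective {ι : Type*} [Fintype ι] (g : ι → F[X])
    (hg : Pairwise (Function.onFun IsCoprime g)) :
    Function.Bijective (AlgHom.pi (R := F) (A := fun i => AdjoinRoot (g i)) fun i =>
      AdjoinRoot.algHomOfDvd F (∏ i, g i) (g i) (Finset.dvd_prod_of_mem g (Finset.mem_univ i))) := by
  have hmk : ∀ (i : ι) (x : F[X]), AdjoinRoot.algHomOfDvd F (∏ i, g i) (g i)
      (Finset.dvd_prod_of_mem g (Finset.mem_univ i)) (AdjoinRoot.mk _ x) = AdjoinRoot.mk (g i) x :=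
    fun i x => algHomOfDvd_mk _ x
  constructor
  · rw [injective_iff_map_eq_zero]
    intro x hx
    obtain ⟨x, rfl⟩ := AdjoinRoot.mk_surjective x
    rw [AdjoinRoot.mk_eq_zero]
    refine Fintype.prod_dvd_of_coprime hg fun i => ?_
    rw [← AdjoinRoot.mk_eq_zero, ← hmk]
    exact congrFun hx i
  · intro y
    obtain ⟨r, hr⟩ := Ideal.pi_quotient_surjective (I := fun i => Ideal.span {g i})
      (fun i j hij => (Ideal.isCoprime_span_singleton_iff _ _).2 (hg hij)) y
    refine ⟨AdjoinRoot.mk _ r, funext fun i => ?_⟩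
    rw [← hr i]
    exact hmk i r

/-- The units modulo a prime power `p ^ (k + 1)` are the elements that are nonzero modulo `p`. -/
theorem natCard_units_adjoinRoot_pow [Finite F] {p : F[X]} (hp : p.Monic ∧ Irreducible p) (k : ℕ) :
    Nat.card (AdjoinRoot (p ^ (k + 1)))ˣ + (Nat.card F ^ p.natDegree) ^ k =
      (Nat.card F ^ p.natDegree) ^ (k + 1) := by
  have := finite_adjoinRoot hp.1
  have := finite_adjoinRoot (hp.1.pow (k + 1))
  have : Fact (Irreducible p) := ⟨hp.2⟩
  let π := AdjoinRoot.algHomOfDvd F (p ^ (k + 1)) p (dvd_pow_self p k.succ_ne_zero)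
  have hmk : ∀ x, π (AdjoinRoot.mk _ x) = AdjoinRoot.mk p x := algHomOfDvd_mk _
  have hunit : ∀ x, IsUnit x ↔ π x ≠ 0 := by
    intro x
    refine ⟨fun h => (h.map π).ne_zero, fun h => ?_⟩
    obtain ⟨x, rfl⟩ := AdjoinRoot.mk_surjective x
    rw [hmk, Ne, AdjoinRoot.mk_eq_zero] at h
    obtain ⟨a, b, hab⟩ := ((hp.2.isCoprime_or_dvd x).resolve_right h).pow_left (m := k + 1)
    refine IsUnit.of_mul_eq_one (AdjoinRoot.mk _ b) ?_
    rw [← map_mul, ← map_one (AdjoinRoot.mk _), AdjoinRoot.mk_eq_mk, ← hab]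
    exact ⟨-a, by ring⟩
  have hsurj : Function.Surjective π := fun y => by
    obtain ⟨y, rfl⟩ := AdjoinRoot.mk_surjective y
    exact ⟨_, hmk y⟩
  have hker := AddSubgroup.card_eq_card_quotient_mul_card_addSubgroup
    (π : AdjoinRoot (p ^ (k + 1)) →+ AdjoinRoot p).ker
  rw [Nat.card_congr (QuotientAddGroup.quotientKerEquivOfSurjective
    (π : AdjoinRoot (p ^ (k + 1)) →+ AdjoinRoot p) hsurj).toEquiv, natCard_adjoinRoot hp.1,
    natCard_adjoinRoot (hp.1.pow _), natDegree_pow, mul_comm (k + 1), pow_mul, pow_succ',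
    Nat.mul_right_inj (pow_ne_zero _ Nat.card_pos.ne')] at hker
  have hsplit : Nat.card (AdjoinRoot (p ^ (k + 1))) = Nat.card (AdjoinRoot (p ^ (k + 1)))ˣ +
      Nat.card (π : AdjoinRoot (p ^ (k + 1)) →+ AdjoinRoot p).ker := by
    classical
    rw [← Nat.card_congr (Equiv.sumCompl fun x => IsUnit x), Nat.card_sum]
    congr 1
    · exact natCard_isUnit _
    · refine Nat.card_congr (Equiv.subtypeEquivRight fun x => ?_)
      rw [hunit, not_not]
      rfl
  rw [natCard_adjoinRoot (hp.1.pow _), natDegree_pow, mul_comm, pow_mul] at hsplit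
  rw [hsplit, hker]

/-- The Euler product for the number of units modulo a monic polynomial. -/
theorem natCard_units_adjoinRoot_toPoly [Finite F] (m : MonicIrr F →₀ ℕ) :
    ((Nat.card (AdjoinRoot (toPoly m))ˣ : ℕ) : ℝ)⁻¹ = invTotient (primeDeg F) (Nat.card F) m := by
  have hcop : Pairwise (Function.onFun IsCoprime fun p : m.support => p.1.1 ^ m p.1) := by
    intro p p' hne
    exact (isCoprime_of_ne p.1.2 p'.1.2 fun h => hne (Subtype.ext (Subtype.ext h))).pow
  have hprod : toPoly m = ∏ p : m.support, p.1.1 ^ m p.1 := by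
    rw [toPoly, Finsupp.prod, ← Finset.prod_coe_sort]
  have e := Units.mapEquiv (MulEquiv.ofBijective _ (adjoinRoot_prod_bijective _ hcop))
  rw [invTotient, ← Finset.prod_coe_sort, hprod, Nat.card_congr (e.trans MulEquiv.piUnits).toEquiv,
    Nat.card_pi, Nat.cast_prod]
  refine congrArg _ (Finset.prod_congr rfl fun p _ => ?_)
  obtain ⟨k, hk⟩ := Nat.exists_eq_succ_of_ne_zero (Finsupp.mem_support_iff.1 p.2)
  have := congrArg (Nat.cast : ℕ → ℝ) (natCard_units_adjoinRoot_pow p.1.2 k)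
  rw [hk]
  push_cast at this
  rw [eq_sub_of_add_eq this, Nat.succ_sub_one]
  ring

end Poly

/-! ### Companion matrices, regularity and semisimplicity -/

section Similarity

variable {F : Type*} [Field F] {n : ℕ}

/-- Similarity of square matrices. -/
def Similar (A B : Matrix (Fin n) (Fin n) F) : Prop :=
  ∃ P : GL (Fin n) F, A = P.val * B * (P⁻¹).val

theorem Similar.symm {A B : Matrix (Fin n) (Fin n) F} (h : Similar A B) : Similar B A := by
  obtain ⟨P, rfl⟩ := h
  exact ⟨P⁻¹, by simp [mul_assoc]⟩

theorem Similar.trans {A B C : Matrix (Fin n) (Fin n) F} (h : Similar A B) (h' : Similar B C) :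
    Similar A C := by
  obtain ⟨P, rfl⟩ := h
  obtain ⟨Q, rfl⟩ := h'
  refine ⟨P * Q, ?_⟩
  rw [mul_inv_rev, Units.val_mul, Units.val_mul]
  simp only [mul_assoc]

theorem Similar.transpose {A B : Matrix (Fin n) (Fin n) F} (h : Similar A B) :
    Similar A.transpose B.transpose := by
  obtain ⟨P, rfl⟩ := h
  refine ⟨⟨(P⁻¹).val.transpose, P.val.transpose, ?_, ?_⟩, ?_⟩
  · rw [← Matrix.transpose_mul, Units.mul_inv, Matrix.transpose_one]
  · rw [← Matrix.transpose_mul, Units.inv_mul, Matrix.transpose_one]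
  · rw [Matrix.transpose_mul, Matrix.transpose_mul, ← mul_assoc]
    rfl

theorem Similar.charpoly_eq {A B : Matrix (Fin n) (Fin n) F} (h : Similar A B) :
    A.charpoly = B.charpoly := by
  obtain ⟨P, rfl⟩ := h
  rw [Matrix.coe_units_inv]
  exact Matrix.charpoly_units_conj P B

theorem similar_leftMulMatrix {R : Type*} [CommRing R] [Algebra F R]
    (b b' : Module.Basis (Fin n) F R) (x : R) :
    Similar (Algebra.leftMulMatrix b x) (Algebra.leftMulMatrix b' x) := by
  refine ⟨⟨b.toMatrix b', b'.toMatrix b, b.toMatrix_mul_toMatrix_flip b',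
    b'.toMatrix_mul_toMatrix_flip b⟩, ?_⟩
  exact (basis_toMatrix_mul_linearMap_toMatrix_mul_basis_toMatrix b b' b b'
    (Algebra.lmul F R x)).symm

/-- The transpose of the companion matrix is the matrix of multiplication by `X` on `F[X] / (f)`
in the basis of powers of `X`. -/
theorem leftMulMatrix_root {f : F[X]} (hf : f.Monic) :
    Algebra.leftMulMatrix (AdjoinRoot.powerBasisAux' hf) (AdjoinRoot.root f) =
      (companion f).transpose := by
  have h := (AdjoinRoot.powerBasis' hf).leftMulMatrix
  have hmin : (AdjoinRoot.powerBasis' hf).minpolyGen = f := by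
    rw [PowerBasis.minpolyGen_eq, AdjoinRoot.powerBasis'_gen, AdjoinRoot.minpoly_root hf.ne_zero,
      hf.leadingCoeff, inv_one, C_1, mul_one]
  rw [hmin] at h
  exact h

theorem charpoly_companion {f : F[X]} (hf : f.Monic) : (companion f).charpoly = f := by
  have h := charpoly_leftMulMatrix (AdjoinRoot.powerBasis' hf)
  rw [AdjoinRoot.powerBasis'_gen, AdjoinRoot.minpoly_root hf.ne_zero,
      hf.leadingCoeff, inv_one, C_1, mul_one] at h
  rw [← Matrix.charpoly_transpose, ← leftMulMatrix_root hf]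
  exact h

/-- For pairwise coprime `g i`, the block diagonal matrix with blocks `C(g i)` is similar to
`C(∏ g i)`: both represent multiplication by `X` on `F[X] / (∏ g i) ≃ ∏ F[X] / (g i)`. -/
theorem similar_blockDiagonal_companion {ι : Type*} [Fintype ι] [DecidableEq ι] (g : ι → F[X])
    (hm : ∀ i, (g i).Monic) (hg : Pairwise (Function.onFun IsCoprime g))
    (σ : (Σ i, Fin (g i).natDegree) ≃ Fin (∏ i, g i).natDegree) :
    Similar (Matrix.reindex σ σ (Matrix.blockDiagonal' fun i => companion (g i)))
      (companion (∏ i, g i)) := by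
  have hf : (∏ i, g i).Monic := monic_prod_of_monic _ _ fun i _ => hm i
  let e := AlgEquiv.ofBijective _ (adjoinRoot_prod_bijective g hg)
  let x : ∀ i, AdjoinRoot (g i) := fun i => AdjoinRoot.root (g i)
  have hx : e (AdjoinRoot.root _) = x := by
    funext i
    exact AdjoinRoot.algHomOfDvd_root (∏ i, g i) (g i)
      (Finset.dvd_prod_of_mem g (Finset.mem_univ i))
  let b := (Pi.basis fun i => AdjoinRoot.powerBasisAux' (hm i)).reindex σ
  let b' := (AdjoinRoot.powerBasisAux' hf).map e.toLinearEquiv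
  have h := (similar_leftMulMatrix b b' x).transpose
  have hb' : (Algebra.leftMulMatrix b' x).transpose = companion (∏ i, g i) := by
    rw [← Matrix.transpose_transpose (companion _), ← leftMulMatrix_root hf]
    congr 1
    ext i j
    rw [Algebra.leftMulMatrix_eq_repr_mul, Algebra.leftMulMatrix_eq_repr_mul]
    simp only [b', Module.Basis.map_apply, Module.Basis.map_repr, LinearEquiv.trans_apply]
    congr 2
    rw [LinearEquiv.symm_apply_eq, ← hx]
    exact (map_mul e _ _).symm
  have hb : (Algebra.leftMulMatrix b x).transpose =
      Matrix.reindex σ σ (Matrix.blockDiagonal' fun i => companion (g i)) := by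
    rw [← Matrix.transpose_transpose (Matrix.reindex σ σ _), Matrix.transpose_reindex,
      Matrix.blockDiagonal'_transpose]
    congr 1
    ext i j
    obtain ⟨⟨i, i'⟩, rfl⟩ := σ.surjective i
    obtain ⟨⟨j, j'⟩, rfl⟩ := σ.surjective j
    rw [Algebra.leftMulMatrix_eq_repr_mul, Matrix.reindex_apply, Matrix.submatrix_apply,
      Equiv.symm_apply_apply, Equiv.symm_apply_apply]
    simp only [b, Module.Basis.reindex_apply, Module.Basis.repr_reindex_apply,
      Equiv.symm_apply_apply, Pi.basis_apply, Pi.basis_repr, Pi.mul_apply]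
    by_cases hij : i = j
    · subst hij
      rw [Pi.single_eq_same, Matrix.blockDiagonal'_apply_eq, ← leftMulMatrix_root (hm i),
        Algebra.leftMulMatrix_eq_repr_mul]
    · rw [Pi.single_eq_of_ne hij, Matrix.blockDiagonal'_apply_ne _ _ _ hij]
      simp
  rwa [hb, hb'] at h

/-- `A` is similar to the companion matrix of `f`; in particular `f` has degree `n`. The
equivalence `finCongr` only identifies the index types. -/
def HasCompanion (f : F[X]) (A : Matrix (Fin n) (Fin n) F) : Prop :=
  ∃ h : f.natDegree = n, Similar A (Matrix.reindex (finCongr h) (finCongr h) (companion f))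

theorem HasCompanion.charpoly_eq {f : F[X]} (hf : f.Monic) {A : Matrix (Fin n) (Fin n) F}
    (h : HasCompanion f A) : A.charpoly = f := by
  obtain ⟨hn, h⟩ := h
  rw [h.charpoly_eq, Matrix.charpoly_reindex, charpoly_companion hf]

/-- A matrix is regular exactly when its rational canonical form can be merged into a single
companion block. -/
theorem isRegularMat_iff (A : Matrix (Fin n) (Fin n) F) :
    IsRegularMat A ↔ ∃ m : MonicIrr F →₀ ℕ,
      Finsupp.weight (primeDeg F) m = n ∧ HasCompanion (toPoly m) A := by
  classical
  constructor
  · rintro ⟨Λ, ⟨k, φ, e, hφ, hΛ, σ, P, hA⟩, hcard⟩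
    have hinj : Function.Injective φ := by
      intro i j hij
      have h := hcard (φ j)
      rw [hΛ, Multiset.card_map, Finset.card_val, Finset.card_le_one] at h
      exact h i (by simpa using hij) j (by simp)
    have hm : ∀ i, (φ i ^ e i).Monic := fun i => (hφ i).1.pow _
    have hcop : Pairwise (Function.onFun IsCoprime fun i => φ i ^ e i) := fun i j hij =>
      (isCoprime_of_ne ⟨(hφ i).1, (hφ i).2.1⟩ ⟨(hφ j).1, (hφ j).2.1⟩ (hinj.ne hij)).pow
    have hdeg : (∏ i, φ i ^ e i).natDegree = n := by
      have := Fintype.card_congr σ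
      rw [Fintype.card_sigma, Fintype.card_fin] at this
      rw [natDegree_prod_of_monic _ _ fun i _ => hm i, ← this]
      exact Finset.sum_congr rfl fun i _ => (Fintype.card_fin _).symm
    obtain ⟨m, hm'⟩ := exists_toPoly_eq (monic_prod_of_monic Finset.univ _ fun i _ => hm i)
    refine ⟨m, by rw [← natDegree_toPoly, hm', hdeg], ?_⟩
    rw [hm']
    subst hdeg
    exact ⟨rfl, Similar.trans ⟨P, hA⟩ (similar_blockDiagonal_companion _ hm hcop σ)⟩
  · rintro ⟨m, rfl, hn, hA⟩
    let ε := (Fintype.equivFin m.support).symm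
    let φ : Fin (Fintype.card m.support) → F[X] := fun i => (ε i).1.1
    let e : Fin (Fintype.card m.support) → ℕ := fun i => m (ε i).1
    have hinj : Function.Injective φ := fun i j hij =>
      ε.injective (Subtype.ext (Subtype.ext hij))
    have hm : ∀ i, (φ i ^ e i).Monic := fun i => (ε i).1.2.1.pow _
    have hcop : Pairwise (Function.onFun IsCoprime fun i => φ i ^ e i) := fun i j hij =>
      (isCoprime_of_ne (ε i).1.2 (ε j).1.2 (hinj.ne hij)).pow
    have hprod : ∏ i, φ i ^ e i = toPoly m := by
      rw [toPoly, Finsupp.prod, ← Finset.prod_coe_sort m.support]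
      exact Equiv.prod_comp ε fun p : m.support => p.1.1 ^ m p.1
    have hcard : Fintype.card (Σ i, Fin (φ i ^ e i).natDegree) =
        Fintype.card (Fin (∏ i, φ i ^ e i).natDegree) := by
      rw [Fintype.card_sigma, Fintype.card_fin, natDegree_prod_of_monic _ _ fun i _ => hm i]
      exact Finset.sum_congr rfl fun i _ => Fintype.card_fin _
    let σ := Fintype.equivOfCardEq hcard
    have hsim := similar_blockDiagonal_companion _ hm hcop σ
    refine ⟨fun p => (Finset.univ.filter fun i => φ i = p).val.map e,
      ⟨_, φ, e, fun i => ⟨(ε i).1.2.1, (ε i).1.2.2, ?_⟩, fun p => ?_, ?_⟩, fun p => ?_⟩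
    · exact Nat.pos_of_ne_zero (Finsupp.mem_support_iff.1 (ε i).2)
    · congr!
    -- The size `n` and the product are only propositionally the indices in use; abstracting both
    -- removes the renumbering of the companion matrix.
    · generalize ∏ i, φ i ^ e i = f at *
      subst hprod
      generalize Finsupp.weight (primeDeg F) m = n at *
      subst hn
      exact ⟨σ, hA.trans hsim.symm⟩
    · rw [Multiset.card_map, Finset.card_val, Finset.card_le_one]
      intro i hi j hj
      rw [Finset.mem_filter] at hi hj
      exact hinj (hi.2.trans hj.2.symm)

/-- The vector of powers of `r` is an eigenvector of the companion matrix up to the defect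
`f(r)` in the last coordinate. -/
theorem companion_mul_powers {K : Type*} [Field K] [Algebra F K] {f : F[X]} (hf : f.Monic) (r : K)
    (i : Fin f.natDegree) :
    ∑ j, algebraMap F K (companion f i j) * r ^ (j : ℕ) =
      r * r ^ (i : ℕ) - if (i : ℕ) + 1 = f.natDegree then aeval r f else 0 := by
  split_ifs with hi
  · simp only [companion, Matrix.of_apply, if_pos hi]
    rw [aeval_eq_sum_range, Finset.sum_range_succ, hf.coeff_natDegree, one_smul,
      Finset.sum_range, ← pow_succ', hi]
    simp [Algebra.smul_def]
  · have hlt : (i : ℕ) + 1 < f.natDegree := by omega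
    simp only [companion, Matrix.of_apply, if_neg hi]
    rw [Finset.sum_eq_single ⟨i + 1, hlt⟩]
    · simp [pow_succ']
    · intro j _ hj
      rw [if_neg fun h => hj (Fin.ext h)]
      simp
    · simp

theorem isSemisimpleMat_companion_iff [PerfectField F] {f : F[X]} (hf : f.Monic) :
    IsSemisimpleMat (companion f) ↔ Squarefree f := by
  rw [← PerfectField.separable_iff_squarefree]
  have hsplit : (f.map (algebraMap F (AlgebraicClosure F))).Splits := IsAlgClosed.splits _
  constructor
  · rintro ⟨P, d, hP⟩
    have hCP : (companion f).map (algebraMap F (AlgebraicClosure F)) * P.val =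
        P.val * Matrix.diagonal d := by
      rw [hP, mul_assoc, Units.inv_mul, mul_one]
    have hentry : ∀ i j, ∑ l, algebraMap F (AlgebraicClosure F) (companion f i l) * P.val l j =
        P.val i j * d j := by
      intro i j
      have := congrFun (congrFun hCP i) j
      rwa [Matrix.mul_apply, Matrix.mul_diagonal] at this
    rcases Nat.eq_zero_or_pos f.natDegree with h0 | hpos
    · rw [hf.natDegree_eq_zero.1 h0]
      exact separable_one
    -- Every row but the last of an eigenvector equation reads `x (i + 1) = d * x i`.
    have hpow : ∀ (i : ℕ) (hi : i < f.natDegree) j,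
        P.val ⟨i, hi⟩ j = d j ^ i * P.val ⟨0, hpos⟩ j := by
      intro i
      induction i with
      | zero => simp
      | succ i ih =>
        intro hi j
        have h := hentry ⟨i, by omega⟩ j
        rw [Finset.sum_eq_single ⟨i + 1, hi⟩] at h
        · simp only [companion, Matrix.of_apply, if_neg hi.ne, if_true, map_one, one_mul] at h
          rw [h, ih (by omega)]
          ring
        · intro l _ hl
          simp only [companion, Matrix.of_apply, if_neg hi.ne]
          rw [if_neg fun h => hl (Fin.ext h)]
          simp
        · simp
    -- The matrix of eigenvectors is a rescaled Vandermonde matrix, so the eigenvalues are distinct.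
    have hPV : P.val = (Matrix.vandermonde d).transpose *
        Matrix.diagonal fun j => P.val ⟨0, hpos⟩ j := by
      ext i j
      rw [Matrix.mul_diagonal, Matrix.transpose_apply, Matrix.vandermonde_apply]
      exact hpow i i.2 j
    have hdet : P.val.det ≠ 0 := ((Matrix.isUnit_iff_isUnit_det _).1 P.isUnit).ne_zero
    rw [hPV, Matrix.det_mul, Matrix.det_transpose, Matrix.det_diagonal] at hdet
    have hinj : Function.Injective d := Matrix.det_vandermonde_ne_zero_iff.1 (left_ne_zero_of_mul hdet)
    have hne : ∀ j, P.val ⟨0, hpos⟩ j ≠ 0 := fun j =>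
      Finset.prod_ne_zero_iff.1 (right_ne_zero_of_mul hdet) j (Finset.mem_univ j)
    have hroot : ∀ j, aeval (d j) f = 0 := by
      intro j
      let i : Fin f.natDegree := ⟨f.natDegree - 1, by omega⟩
      have hi : (i : ℕ) + 1 = f.natDegree := Nat.sub_add_cancel hpos
      have h1 := companion_mul_powers hf (d j) i
      rw [if_pos hi] at h1
      have h2 := hentry i j
      simp only [hpow _ (Fin.is_lt _), ← mul_assoc, ← Finset.sum_mul] at h2
      rw [h1] at h2
      have h3 : aeval (d j) f * P.val ⟨0, hpos⟩ j = 0 := by linear_combination -h2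
      exact (mul_eq_zero.1 h3).resolve_right (hne j)
    rw [← card_rootSet_eq_natDegree_iff_of_splits hf.ne_zero hsplit]
    refine le_antisymm ?_ ?_
    · rw [← Nat.card_eq_fintype_card]
      exact ncard_rootSet_le _ _
    · conv_lhs => rw [← Fintype.card_fin f.natDegree]
      refine Fintype.card_le_of_injective
        (fun j => ⟨d j, (mem_rootSet).2 ⟨hf.ne_zero, hroot j⟩⟩) fun i j h => ?_
      exact hinj (congrArg Subtype.val h)
  · intro hsep
    have hc := (card_rootSet_eq_natDegree_iff_of_splits hf.ne_zero hsplit).2 hsep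
    let d := (Fintype.equivFinOfCardEq hc).symm
    have hdet : (Matrix.vandermonde fun j => (d j : AlgebraicClosure F)).transpose.det ≠ 0 := by
      rw [Matrix.det_transpose]
      exact Matrix.det_vandermonde_ne_zero_iff.2 (Subtype.val_injective.comp d.injective)
    refine ⟨Matrix.GeneralLinearGroup.mkOfDetNeZero _ hdet, fun j => d j, ?_⟩
    rw [Units.eq_mul_inv_iff_mul_eq]
    ext i j
    have h := companion_mul_powers hf (d j : AlgebraicClosure F) i
    rw [(mem_rootSet.1 (d j).2).2, ite_self, sub_zero] at h
    rw [Matrix.mul_apply]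
    erw [Matrix.mul_diagonal]
    simp only [Matrix.map_apply]
    rw [mul_comm] at h
    exact h

theorem Similar.isSemisimpleMat {A B : Matrix (Fin n) (Fin n) F} (h : Similar A B)
    (hB : IsSemisimpleMat B) : IsSemisimpleMat A := by
  obtain ⟨Q, rfl⟩ := h
  obtain ⟨P, d, hP⟩ := hB
  refine ⟨Matrix.GeneralLinearGroup.map (algebraMap F (AlgebraicClosure F)) Q * P, d, ?_⟩
  rw [Matrix.map_mul, Matrix.map_mul, hP, mul_inv_rev, ← map_inv, Units.val_mul, Units.val_mul]
  simp only [mul_assoc]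
  rfl

theorem HasCompanion.isSemisimpleMat_iff [PerfectField F] {f : F[X]} (hf : f.Monic)
    {A : Matrix (Fin n) (Fin n) F} (h : HasCompanion f A) :
    IsSemisimpleMat A ↔ Squarefree f := by
  obtain ⟨rfl, h⟩ := h
  rw [← isSemisimpleMat_companion_iff hf]
  exact ⟨fun hA => h.symm.isSemisimpleMat hA, fun hC => h.isSemisimpleMat hC⟩

/-- The matrices commuting with multiplication by `X` on `F[X] / (f)` are the multiplications. -/
theorem mem_range_leftMulMatrix {f : F[X]} (hf : f.Monic)
    (T : Matrix (Fin f.natDegree) (Fin f.natDegree) F)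
    (hT : T * Algebra.leftMulMatrix (AdjoinRoot.powerBasisAux' hf) (AdjoinRoot.root f) =
      Algebra.leftMulMatrix (AdjoinRoot.powerBasisAux' hf) (AdjoinRoot.root f) * T) :
    ∃ t, Algebra.leftMulMatrix (AdjoinRoot.powerBasisAux' hf) t = T := by
  let b := AdjoinRoot.powerBasisAux' hf
  let L := Matrix.toLin b b T
  have hLroot : ∀ x, L (AdjoinRoot.root f * x) = AdjoinRoot.root f * L x := by
    intro x
    have h := congrArg (Matrix.toLin b b) hT
    rw [Matrix.toLin_mul b b b, Matrix.toLin_mul b b b, Algebra.leftMulMatrix_apply,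
      Matrix.toLin_toMatrix] at h
    exact LinearMap.congr_fun h x
  have hL : ∀ x, L x = L 1 * x := by
    intro x
    obtain ⟨x, rfl⟩ := AdjoinRoot.mk_surjective x
    induction x using Polynomial.induction_on with
    | C a =>
      rw [AdjoinRoot.mk_C, ← mul_one (AdjoinRoot.of f a)]
      have : ∀ y, AdjoinRoot.of f a * y = a • y := fun y => (Algebra.smul_def a y).symm
      rw [this, map_smul, mul_smul_comm, mul_one]
    | add p p' hp hp' => rw [map_add, map_add, hp, hp', mul_add]
    | monomial k a ih =>
      rw [pow_succ', show C a * (X * X ^ k) = X * (C a * X ^ k) by ring, map_mul, AdjoinRoot.mk_X,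
        hLroot, ih]
      ring
  refine ⟨L 1, ?_⟩
  rw [Algebra.leftMulMatrix_apply, ← LinearMap.toMatrix_toLin b b T]
  congr 1
  ext x
  exact (hL x).symm

/-- Orbit–stabilizer for the conjugation action of the general linear group: the stabilizer of a
companion matrix is the unit group of `F[X] / (f)`. -/
theorem natCard_hasCompanion_mul [Finite F] {f : F[X]} (hf : f.Monic) (hn : f.natDegree = n) :
    Nat.card {A : Matrix (Fin n) (Fin n) F // HasCompanion f A} * Nat.card (AdjoinRoot f)ˣ =
      Nat.card (GL (Fin n) F) := by
  subst hn
  let b := AdjoinRoot.powerBasisAux' hf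
  let B := Algebra.leftMulMatrix b (AdjoinRoot.root f)
  have horb : Nat.card {A : Matrix (Fin f.natDegree) (Fin f.natDegree) F // HasCompanion f A} =
      (MulAction.orbit (ConjAct (GL (Fin f.natDegree) F)) B).ncard := by
    rw [← Nat.card_coe_set_eq]
    refine Nat.card_congr (Equiv.subtypeEquiv
      ⟨Matrix.transpose, Matrix.transpose, Matrix.transpose_transpose,
        Matrix.transpose_transpose⟩ fun A => ?_)
    have h1 : HasCompanion f A ↔ Similar A (companion f) :=
      ⟨fun h => h.choose_spec, fun h => ⟨rfl, h⟩⟩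
    have h2 : Similar A (companion f) ↔ Similar A.transpose B := by
      have hB : B = (companion f).transpose := leftMulMatrix_root hf
      rw [hB]
      exact ⟨fun h => h.transpose, fun h => by simpa using h.transpose⟩
    rw [h1, h2]
    constructor
    · rintro ⟨P, hP⟩
      exact ⟨ConjAct.toConjAct P, hP.symm⟩
    · rintro ⟨P, hP⟩
      exact ⟨ConjAct.ofConjAct P, hP.symm⟩
  have hstab : Nat.card (AdjoinRoot f)ˣ =
      Nat.card (MulAction.stabilizer (ConjAct (GL (Fin f.natDegree) F)) B) := by
    have hmem : ∀ P : ConjAct (GL (Fin f.natDegree) F),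
        P ∈ MulAction.stabilizer (ConjAct (GL (Fin f.natDegree) F)) B ↔
          (ConjAct.ofConjAct P).val * B = B * (ConjAct.ofConjAct P).val := by
      intro P
      rw [MulAction.mem_stabilizer_iff, ConjAct.units_smul_def, Units.mul_inv_eq_iff_eq_mul]
    refine Nat.card_congr (Equiv.ofBijective (fun u => ⟨ConjAct.toConjAct
      (Units.map (Algebra.leftMulMatrix b : AdjoinRoot f →* _) u), ?_⟩) ⟨?_, ?_⟩)
    · rw [hmem]
      change Algebra.leftMulMatrix b u.1 * Algebra.leftMulMatrix b _ =
        Algebra.leftMulMatrix b _ * Algebra.leftMulMatrix b u.1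
      rw [← map_mul, mul_comm, map_mul]
    · intro u v h
      have h' : Algebra.leftMulMatrix b u.1 = Algebra.leftMulMatrix b v.1 :=
        congrArg (fun P => (ConjAct.ofConjAct P.1).val) h
      exact Units.ext (Algebra.leftMulMatrix_injective b h')
    · rintro ⟨P, hP⟩
      have hP' := inv_mem hP
      rw [hmem] at hP hP'
      obtain ⟨t, ht⟩ := mem_range_leftMulMatrix hf _ hP
      obtain ⟨t', ht'⟩ := mem_range_leftMulMatrix hf _ hP'
      have htt : t * t' = 1 := by
        apply Algebra.leftMulMatrix_injective b
        rw [map_mul, map_one]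
        change Algebra.leftMulMatrix (AdjoinRoot.powerBasisAux' hf) t *
          Algebra.leftMulMatrix (AdjoinRoot.powerBasisAux' hf) t' = 1
        rw [ht, ht', ConjAct.ofConjAct_inv, Units.mul_inv]
      refine ⟨⟨t, t', htt, by rw [mul_comm, htt]⟩, Subtype.ext ?_⟩
      exact congrArg ConjAct.toConjAct (Units.ext ht)
  rw [horb, hstab, ← MulAction.index_stabilizer, mul_comm, Subgroup.card_mul_index]
  rfl

end Similarity

/-! ### Counting matrices -/

section Limit

variable {F : Type*} [Field F]

theorem natCard_exists_eq_sum {α ι : Type*} [Finite α] (s : Finset ι) (R : ι → α → Prop)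
    (hR : ∀ a i j, R i a → R j a → i = j) :
    Nat.card {a // ∃ i ∈ s, R i a} = ∑ i ∈ s, Nat.card {a // R i a} := by
  classical
  have := Fintype.ofFinite α
  simp_rw [Nat.card_eq_fintype_card, Fintype.card_subtype]
  rw [← Finset.card_biUnion]
  · congr 1
    ext a
    simp
  · intro i _ j _ hij
    refine Finset.disjoint_left.2 fun a hi hj => hij ?_
    exact hR a i j (Finset.mem_filter.1 hi).2 (Finset.mem_filter.1 hj).2

/-- The probability of having a companion form in a given family is the product of the
probability of being invertible and the sum of the reciprocal unit counts. -/
theorem matProb_exists_hasCompanion [Finite F] {n : ℕ} (s : Finset (MonicIrr F →₀ ℕ))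
    (hs : ∀ m ∈ s, Finsupp.weight (primeDeg F) m = n) :
    matProb F n (fun A => ∃ m ∈ s, HasCompanion (toPoly m) A) =
      matProb F n (fun A => IsUnit A) * ∑ m ∈ s, invTotient (primeDeg F) (Nat.card F) m := by
  rw [matProb, matProb, natCard_exists_eq_sum s, natCard_isUnit, div_mul_eq_mul_div]
  · congr 1
    rw [Finset.mul_sum]
    push_cast
    refine Finset.sum_congr rfl fun m hm => ?_
    rw [← natCard_units_adjoinRoot_toPoly, ← natCard_hasCompanion_mul (monic_toPoly m)
      (by rw [natDegree_toPoly, hs m hm])]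
    have := finite_adjoinRoot (monic_toPoly m)
    have hne : ((Nat.card (AdjoinRoot (toPoly m))ˣ : ℕ) : ℝ) ≠ 0 :=
      Nat.cast_ne_zero.2 Nat.card_pos.ne'
    push_cast
    field_simp
  · intro A m m' h h'
    refine toPoly_injective ?_
    rw [← h.charpoly_eq (monic_toPoly m), h'.charpoly_eq (monic_toPoly m')]

theorem matProb_isUnit [Finite F] (n : ℕ) :
    matProb F n (fun A => IsUnit A) =
      ∏ r ∈ Finset.range n, (1 - 1 / (Nat.card F : ℝ) ^ (r + 1)) := by
  have := Fintype.ofFinite F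
  have hq : (Nat.card F : ℝ) ≠ 0 := Nat.cast_ne_zero.2 Nat.card_pos.ne'
  have hM : (Nat.card (Matrix (Fin n) (Fin n) F) : ℝ) =
      ∏ _r ∈ Finset.range n, (Nat.card F : ℝ) ^ n := by
    rw [Finset.prod_const, Finset.card_range, Matrix, Nat.card_fun, Nat.card_fun, Nat.card_fin]
    push_cast
    rfl
  rw [matProb, natCard_isUnit, Matrix.card_GL_field, hM, ← Nat.card_eq_fintype_card, Nat.cast_prod,
    Fin.prod_univ_eq_prod_range (fun i => ((Nat.card F ^ n - Nat.card F ^ i : ℕ) : ℝ)),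
    ← Finset.prod_div_distrib, ← Finset.prod_range_reflect]
  refine Finset.prod_congr rfl fun r hr => ?_
  rw [Finset.mem_range] at hr
  rw [Nat.cast_sub (Nat.pow_le_pow_right Nat.card_pos (by omega)), Nat.cast_pow, Nat.cast_pow,
    sub_div, div_self (pow_ne_zero _ hq), div_eq_div_iff (pow_ne_zero _ hq) (pow_ne_zero _ hq) |>.2]
  rw [one_mul, ← pow_add]
  congr 1
  omega

theorem multipliable_one_sub_inv_pow {q : ℕ} (hq : 2 ≤ q) (k : ℕ) :
    Multipliable fun r : ℕ => 1 - 1 / (q : ℝ) ^ (r + k) := by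
  have hq' : (2 : ℝ) ≤ q := by exact_mod_cast hq
  have hs : Summable fun r : ℕ => -(1 / (q : ℝ) ^ (r + k)) := by
    refine Summable.neg ?_
    have := (summable_geometric_of_lt_one (r := (q : ℝ)⁻¹) (by positivity)
      (inv_lt_one_of_one_lt₀ (by linarith)))
    refine ((summable_nat_add_iff k).2 this).congr fun r => ?_
    rw [inv_pow, one_div]
  exact Real.multipliable_one_add_of_summable hs

end Limit

end RandomMatrix

theorem mainTheorem8 {F : Type*} [Field F] [Finite F] (q : ℕ) (hq : Nat.card F = q) :
    (Multipliable (fun r : ℕ => 1 - 1 / (q : ℝ) ^ (r + 3)) ∧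
      Tendsto (fun n : ℕ => RandomMatrix.matProb F n RandomMatrix.IsRegularMat) atTop
        (𝓝 ((1 - 1 / (q : ℝ) ^ 5) * ∏' r : ℕ, (1 - 1 / (q : ℝ) ^ (r + 3))))) ∧
    (Multipliable (fun r : ℕ => 1 - 1 / (q : ℝ) ^ (r + 1)) ∧
      Tendsto (fun n : ℕ => RandomMatrix.matProb F n RandomMatrix.IsRegSemisimpleMat) atTop
        (𝓝 (∏' r : ℕ, (1 - 1 / (q : ℝ) ^ (r + 1))))) := by
  classical
  have hq2 : 2 ≤ q := hq ▸ Finite.one_lt_card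
  have hN : ∀ n, Nat.card {m : RandomMatrix.MonicIrr F →₀ ℕ //
      Finsupp.weight (RandomMatrix.primeDeg F) m = n} = q ^ n := fun n => by
    rw [RandomMatrix.natCard_monic, hq]
  have hfin := RandomMatrix.finite_slices hN hq2
  have hm1 := RandomMatrix.multipliable_one_sub_inv_pow hq2 1
  have hm3 := RandomMatrix.multipliable_one_sub_inv_pow hq2 3
  have hGL : Tendsto (fun n => RandomMatrix.matProb F n fun A => IsUnit A) atTop
      (𝓝 (∏' r : ℕ, (1 - 1 / (q : ℝ) ^ (r + 1)))) := by
    simp_rw [RandomMatrix.matProb_isUnit, hq]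
    exact hm1.hasProd.tendsto_prod_nat
  refine ⟨⟨hm3, ?_⟩, hm1, ?_⟩
  · have hlim := hGL.mul (RandomMatrix.tendsto_sum_invTotient hN hq2 RandomMatrix.primeDeg_pos hfin)
    have hval : (∏' r : ℕ, (1 - 1 / (q : ℝ) ^ (r + 1))) *
        ((1 - ((q : ℝ) ^ 5)⁻¹) / ((1 - ((q : ℝ) ^ 1)⁻¹) * (1 - ((q : ℝ) ^ 2)⁻¹))) =
        (1 - 1 / (q : ℝ) ^ 5) * ∏' r : ℕ, (1 - 1 / (q : ℝ) ^ (r + 3)) := by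
      have hsplit := hm3.prod_mul_tprod_nat_mul' (k := 2) (f := fun r : ℕ => 1 - 1 / (q : ℝ) ^ (r + 1))
      rw [← hsplit, Finset.prod_range_succ, Finset.prod_range_one]
      have hlt : ∀ k : ℕ, k ≠ 0 → 1 - ((q : ℝ) ^ k)⁻¹ ≠ 0 := fun k hk =>
        (sub_pos.2 (inv_lt_one_of_one_lt₀ (one_lt_pow₀ (by exact_mod_cast hq2) hk))).ne'
      have h1 := hlt 1 one_ne_zero
      have h2 := hlt 2 two_ne_zero
      simp only [one_div, zero_add, Nat.reduceAdd, add_assoc]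
      rw [mul_div_assoc', div_eq_iff (mul_ne_zero h1 h2)]
      ring
    rw [hval] at hlim
    refine hlim.congr fun n => ?_
    rw [← hq, ← RandomMatrix.matProb_exists_hasCompanion _ fun m hm => RandomMatrix.mem_slice.1 hm]
    congr 1
    funext A
    rw [RandomMatrix.isRegularMat_iff]
    simp only [RandomMatrix.mem_slice]
  · have hlim := hGL.mul
      (RandomMatrix.tendsto_sum_invTotient_squarefree hN hq2 RandomMatrix.primeDeg_pos hfin)
    rw [mul_one] at hlim
    refine hlim.congr fun n => ?_
    rw [← hq, ← RandomMatrix.matProb_exists_hasCompanion _ fun m hm =>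
      RandomMatrix.mem_slice.1 (Finset.mem_filter.1 hm).1]
    congr 1
    funext A
    rw [RandomMatrix.IsRegSemisimpleMat, RandomMatrix.isRegularMat_iff, eq_iff_iff]
    simp only [Finset.mem_filter, RandomMatrix.mem_slice, ← RandomMatrix.squarefree_toPoly_iff]
    constructor
    · rintro ⟨m, ⟨hn, hsq⟩, hA⟩
      exact ⟨⟨m, hn, hA⟩, (hA.isSemisimpleMat_iff (RandomMatrix.monic_toPoly m)).2 hsq⟩
    · rintro ⟨⟨m, hn, hA⟩, hss⟩
      exact ⟨m, ⟨hn, (hA.isSemisimpleMat_iff (RandomMatrix.monic_toPoly m)).1 hss⟩, hA⟩
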